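/- Let $G$ be a finite simple graph and let $p$ be a real number with $0<p\le 1$. In the \emph{fractional brushing game} with parameter $p$ on $G$, all vertices are initially dirty and carry no brushes. Two players, Min and Max, alternate turns, Min moving first; on each turn the player to move adds one brush to a dirty vertex. Whenever a dirty vertex holds at least $p$ times as many brushes as it has dirty neighbours, it fires: it sends $p$ brushes to each of its dirty neighbours and becomes clean. Firing continues until no dirty vertex can fire (in particular, isolated vertices become clean before the first turn), and then the next turn begins. The game ends when all vertices are clean; Min wants to minimize and Max wants to maximize the number of turns. Let $b_{g,p}(G)$ be the number of turns under optimal play, and let $b_g(G)=b_{g,1}(G)$, the length of the ordinary brushing game (the \emph{game brush number}). \textbf{Theorem.} For every $n$-vertex graph $G$ and every $p=p(n)\in(0,1]$, $$b_{g,p}(G)=(1+o(1))\,p\,b_g(G)+O(n\ln n)\qquad (n\to\infty),$$ uniformly in $G$ and $p$. That is, there are a constant $C$ and a function $\varepsilon:\mathbb N\to\mathbb R$ with $\varepsilon(n)\to 0$ such that for every $n$, every graph $G$ on $n$ vertices and every $p\in(0,1]$ there are reals $\delta,e$ with $|\delta|\le\varepsilon(n)$, $|e|\le C\,n\ln n$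 and $b_{g,p}(G)=(1+\delta)\,p\,b_g(G)+e$. -/

import Mathlib

noncomputable section

open scoped Classical

/-- A position of the brushing game: the set of dirty vertices, and the number of brushes
on each vertex (a real number, since in the fractional game brushes are split). -/
structure BrushState (V : Type*) where
  dirty : Finset V
  brushes : V → ℝ

namespace BrushState

variable {V : Type*}

/-- The dirty neighbours of `v`. -/
def dirtyNbrs (G : SimpleGraph V) (s : BrushState V) (v : V) : Finset V :=
  s.dirty.filter fun u => G.Adj v u

/-- A dirty vertex is ready to fire when it holds at least `p` times as many brushes as it has
dirty neighbours. -/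
def Ready (p : ℝ) (G : SimpleGraph V) (s : BrushState V) (v : V) : Prop :=
  v ∈ s.dirty ∧ p * ((s.dirtyNbrs G v).card : ℝ) ≤ s.brushes v

/-- Firing `v`: it sends `p` brushes to each of its dirty neighbours and becomes clean. -/
def fire (p : ℝ) (G : SimpleGraph V) (s : BrushState V) (v : V) : BrushState V where
  dirty := s.dirty.erase v
  brushes := fun u =>
    if u = v then s.brushes u - p * ((s.dirtyNbrs G v).card : ℝ)
    else if u ∈ s.dirtyNbrs G v then s.brushes u + p
    else s.brushes u

/-- Fire ready vertices, one at a time and in an arbitrary order, until none is left. -/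
def stabilize (p : ℝ) (G : SimpleGraph V) (s : BrushState V) : BrushState V :=
  if h : ∃ v, s.Ready p G v then stabilize p G (s.fire p G h.choose) else s
termination_by s.dirty.card
decreasing_by exact Finset.card_erase_lt_of_mem h.choose_spec.1

/-- Put one more brush on `v`. -/
def place (s : BrushState V) (v : V) : BrushState V where
  dirty := s.dirty
  brushes := Function.update s.brushes v (s.brushes v + 1)

/-- A turn: one brush is placed on `v`, and then vertices fire until the position is stable. -/
def play (p : ℝ) (G : SimpleGraph V) (s : BrushState V) (v : V) : BrushState V :=
  (s.place v).stabilize p G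

/-- The starting position: all vertices are dirty and there are no brushes. (Vertices which are
ready at once, that is isolated ones, fire before the first turn.) -/
def start (p : ℝ) (G : SimpleGraph V) [Fintype V] : BrushState V :=
  stabilize p G ⟨Finset.univ, fun _ => 0⟩

end BrushState

/-- The two players. -/
inductive BrushPlayer
  | Min
  | Max

/-- `EndsWithin p G k P s`: from the position `s`, with player `P` to move, Min can guarantee
that all vertices are clean after at most `k` further turns. On each turn the player to move
chooses a dirty vertex. -/
def EndsWithin {V : Type*} (p : ℝ) (G : SimpleGraph V) :
    ℕ → BrushPlayer → BrushState V → Prop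
  | 0, _, s => s.dirty = ∅
  | k + 1, BrushPlayer.Min, s =>
      s.dirty = ∅ ∨ ∃ v ∈ s.dirty, EndsWithin p G k BrushPlayer.Max (s.play p G v)
  | k + 1, BrushPlayer.Max, s =>
      s.dirty = ∅ ∨ ∀ v ∈ s.dirty, EndsWithin p G k BrushPlayer.Min (s.play p G v)

/-- The length, under optimal play, of the Min-start fractional brushing game with
parameter `p` on `G`. -/
def fracGameBrushNumber {V : Type*} [Fintype V] (p : ℝ) (G : SimpleGraph V) : ℕ :=
  sInf {k | EndsWithin p G k BrushPlayer.Min (BrushState.start p G)}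

/-- The game brush number of `G`: the length, under optimal play, of the ordinary Min-start
brushing game, in which a vertex fires when it has at least as many brushes as dirty neighbours
and then sends one brush to each of them. -/
def gameBrushNumber {V : Type*} [Fintype V] (G : SimpleGraph V) : ℕ :=
  fracGameBrushNumber 1 G

/-! The game always ends, so the infimum above is attained and is never a default value. -/

namespace BrushState

variable {V : Type*}

lemma stabilize_dirty_subset (p : ℝ) (G : SimpleGraph V) (s : BrushState V) :
    (s.stabilize p G).dirty ⊆ s.dirty := by
  induction s using stabilize.induct p G with
  | case1 s h ih =>
    rw [stabilize, dif_pos h]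
    exact ih.trans (Finset.erase_subset _ _)
  | case2 s h => rw [stabilize, dif_neg h]

lemma stabilize_card_lt (p : ℝ) (G : SimpleGraph V) (s : BrushState V)
    (h : ∃ v, s.Ready p G v) : (s.stabilize p G).dirty.card < s.dirty.card := by
  rw [stabilize, dif_pos h]
  exact (Finset.card_le_card (stabilize_dirty_subset p G _)).trans_lt
    (Finset.card_erase_lt_of_mem h.choose_spec.1)

end BrushState

lemma EndsWithin.succ {V : Type*} {p : ℝ} {G : SimpleGraph V} {k : ℕ} :
    ∀ {P : BrushPlayer} {s : BrushState V}, EndsWithin p G k P s → EndsWithin p G (k + 1) P s := by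
  induction k with
  | zero => intro P s h; cases P <;> exact Or.inl h
  | succ k ih =>
    intro P s h
    cases P with
    | Min => exact h.imp id fun ⟨v, hv, h⟩ => ⟨v, hv, ih h⟩
    | Max => exact h.imp id fun h v hv => ih (h v hv)

lemma EndsWithin.mono {V : Type*} {p : ℝ} {G : SimpleGraph V} {k l : ℕ} (hkl : k ≤ l)
    {P : BrushPlayer} {s : BrushState V} (h : EndsWithin p G k P s) : EndsWithin p G l P s := by
  induction hkl with
  | refl => exact h
  | step _ ih => exact ih.succ

lemma exists_endsWithin {V : Type*} {p : ℝ} (hp : 0 ≤ p) (G : SimpleGraph V) :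
    ∀ (d m : ℕ) (P : BrushPlayer) (s : BrushState V), s.dirty.card ≤ d →
      (∑ v ∈ s.dirty, ⌈p * d - s.brushes v⌉₊) ≤ m → ∃ k, EndsWithin p G k P s := by
  intro d
  induction d with
  | zero =>
    intro m P s hs _
    exact ⟨0, Finset.card_eq_zero.mp (Nat.le_zero.mp hs)⟩
  | succ d ihd =>
    intro m
    induction m using Nat.strong_induction_on with
    | _ m ihm =>
    intro P s hs hm
    have key : ∀ (Q : BrushPlayer), ∀ v ∈ s.dirty, ∃ k, EndsWithin p G k Q (s.play p G v) := by
      intro Q v hv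
      by_cases h : ∃ u, (s.place v).Ready p G u
      · refine ihd _ Q _ ?_ le_rfl
        have := BrushState.stabilize_card_lt p G (s.place v) h
        have h2 : (s.place v).dirty = s.dirty := rfl
        rw [h2] at this
        unfold BrushState.play
        omega
      · have hplay : s.play p G v = s.place v := by
          rw [BrushState.play, BrushState.stabilize, dif_neg h]
        rw [hplay]
        have hnr : s.brushes v + 1 < p * (d + 1 : ℕ) := by
          have h1 : ¬ (s.place v).Ready p G v := fun h' => h ⟨v, h'⟩
          have h2 : s.brushes v + 1 < p * (((s.place v).dirtyNbrs G v).card : ℝ) := by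
            by_contra hc
            exact h1 ⟨hv, by simpa [BrushState.place] using not_lt.mp hc⟩
          refine h2.trans_le (mul_le_mul_of_nonneg_left ?_ hp)
          exact_mod_cast (Finset.card_le_card (Finset.filter_subset _ _)).trans hs
        have hlt : (∑ u ∈ s.dirty, ⌈p * (d + 1 : ℕ) - (s.place v).brushes u⌉₊)
            < ∑ u ∈ s.dirty, ⌈p * (d + 1 : ℕ) - s.brushes u⌉₊ := by
          refine Finset.sum_lt_sum (fun u _ => Nat.ceil_mono ?_) ⟨v, hv, ?_⟩
          · by_cases huv : u = v
            · subst huv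
              simp only [BrushState.place, Function.update_self]
              linarith
            · simp [BrushState.place, huv]
          · have : (s.place v).brushes v = s.brushes v + 1 := by simp [BrushState.place]
            rw [this, Nat.lt_ceil]
            have := Nat.ceil_lt_add_one (a := p * (d + 1 : ℕ) - (s.brushes v + 1)) (by linarith)
            linarith
        exact ihm _ (hlt.trans_le hm) Q _ hs le_rfl
    by_cases he : s.dirty = ∅
    · exact ⟨0, he⟩
    obtain ⟨v, hv⟩ := Finset.nonempty_iff_ne_empty.mpr he
    cases P with
    | Min =>
      obtain ⟨k, hk⟩ := key BrushPlayer.Max v hv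
      exact ⟨k + 1, Or.inr ⟨v, hv, hk⟩⟩
    | Max =>
      choose! f hf using key BrushPlayer.Min
      exact ⟨s.dirty.sup f + 1, Or.inr fun u hu => (hf u hu).mono (Finset.le_sup hu)⟩

lemma endsWithin_fracGameBrushNumber {V : Type*} [Fintype V] {p : ℝ} (hp : 0 ≤ p)
    (G : SimpleGraph V) :
    EndsWithin p G (fracGameBrushNumber p G) BrushPlayer.Min (BrushState.start p G) := by
  have h : {k | EndsWithin p G k BrushPlayer.Min (BrushState.start p G)}.Nonempty :=
    exists_endsWithin hp G _ _ _ _ le_rfl le_rfl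
  exact Nat.sInf_mem h

end

/-!
Measure loads in units of `p`: each turn then adds `p⁻¹` to the load of a dirty vertex, and the
dirty vertices are the largest set in which no vertex can fire, a set which shrinks as the loads
grow. Compare the game with steps `g` and the game with steps `g * k`, whose moves are `k` times
as long. Min plays either one by following an optimal strategy for the other, in which `k` of her
short moves stand for one long move. Her opponent's short moves do not arrive in such batches: each
block of `k` of them is a unit of water poured into cups, one for each vertex, and Min answers by
emptying the fullest cup by one unit. As in the cup emptying game this keeps every level below a
harmonic number, so that the imitation costs only `O(n log n)` long moves.

Hence the length `F p` of the game with parameter `p` satisfies `k * F p = F (k * p) + O(k n log n)`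
for all positive integers `k`. As `F` is monotone, `F p = p * F 1 + O((1 + p) n log n)`.
-/

section LoadGame

variable {V : Type*} {D : (V → ℝ) → Finset V} {x y : V → ℝ}

/-- In a game whose dirty set is a function `D` of the load on each vertex, the load `y` is at
least as good for Min as `x`: only the vertices that are still dirty at `y` matter. -/
def LoadLE (D : (V → ℝ) → Finset V) (x y : V → ℝ) : Prop := ∀ v ∈ D y, x v ≤ y v

/-- Raising loads cleans vertices, and the loads of clean vertices are irrelevant. -/
def IsDirtyMap (D : (V → ℝ) → Finset V) : Prop := ∀ ⦃x y⦄, LoadLE D x y → D y ⊆ D x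

lemma LoadLE.of_le (h : x ≤ y) : LoadLE D x y := fun v _ => h v

lemma IsDirtyMap.subset_add (hD : IsDirtyMap D) (x : V → ℝ) {a : V → ℝ} (ha : 0 ≤ a) :
    D (x + a) ⊆ D x := hD (.of_le (le_add_of_nonneg_right ha))

lemma LoadLE.add_right (hD : IsDirtyMap D) (h : LoadLE D x y) {a : V → ℝ} (ha : 0 ≤ a) :
    LoadLE D (x + a) (y + a) :=
  fun v hv => add_le_add_left (h v (hD.subset_add y ha hv)) (a v)

lemma LoadLE.of_add_left {a : V → ℝ} (ha : 0 ≤ a) (h : LoadLE D (x + a) y) : LoadLE D x y :=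
  fun v hv => (le_add_of_nonneg_right (ha v)).trans (h v hv)

lemma exists_mem_eq_of_mem {S : Finset V} (hS : S.Nonempty) (v : V) : ∃ u ∈ S, v ∈ S → u = v := by
  by_cases hv : v ∈ S
  · exact ⟨v, hv, fun _ => rfl⟩
  · exact ⟨hS.choose, hS.choose_spec, fun h => absurd h hv⟩

/-- The load added by `m v` moves on each vertex `v` in the game with step `g`. -/
def moveLoad (g : ℝ) (m : V → ℕ) : V → ℝ := fun v => g * m v

@[simp]
lemma moveLoad_zero (g : ℝ) : moveLoad g (0 : V → ℕ) = 0 := by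
  ext v
  simp [moveLoad]

lemma moveLoad_add (g : ℝ) (m r : V → ℕ) :
    moveLoad g (m + r) = moveLoad g m + moveLoad g r := by
  ext v
  simp [moveLoad, mul_add]

lemma moveLoad_eq_smul (g : ℝ) {k : ℕ} (hk : 0 < k) (r : V → ℕ) :
    moveLoad g r = (g * k) • fun v => (r v : ℝ) / k := by
  ext v
  simp only [moveLoad, Pi.smul_apply, smul_eq_mul]
  field_simp

variable [DecidableEq V]

lemma moveLoad_single (g : ℝ) (v : V) (j : ℕ) :
    moveLoad g (Pi.single v j) = Pi.single v (g * j) := by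
  ext w
  by_cases hwv : w = v <;> simp [moveLoad, hwv]

lemma LoadLE.self_add_single (x : V → ℝ) (v : V) {h : ℝ} (hh : 0 ≤ h) :
    LoadLE D x (x + Pi.single v h) := .of_le (le_add_of_nonneg_right (Pi.single_nonneg.mpr hh))

lemma IsDirtyMap.subset_add_single (hD : IsDirtyMap D) (x : V → ℝ) (v : V) {h : ℝ}
    (hh : 0 ≤ h) : D (x + Pi.single v h) ⊆ D x := hD.subset_add x (Pi.single_nonneg.mpr hh)

lemma LoadLE.add_single (hD : IsDirtyMap D) {g h : ℝ} (hg : 0 ≤ g) (hgh : g ≤ h)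
    (hxy : LoadLE D x y) {u v : V} (huv : v ∈ D y → u = v) :
    LoadLE D (x + Pi.single v g) (y + Pi.single u h) := by
  intro w hw
  have hwy : w ∈ D y := hD.subset_add_single y u (hg.trans hgh) hw
  refine add_le_add (hxy w hwy) ?_
  by_cases hwv : w = v
  · subst hwv
    simpa [huv hwy] using hgh
  · rw [Pi.single_eq_of_ne hwv]
    exact (Pi.single_nonneg.mpr (hg.trans hgh) : (0 : V → ℝ) ≤ Pi.single u h) w

/-- The game in which the players alternately add `h` to the load of a dirty vertex:
from the load `x`, with player `P` to move, Min can reach an empty dirty set within `k` turns. -/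
def ClearsWithin (D : (V → ℝ) → Finset V) (h : ℝ) : ℕ → BrushPlayer → (V → ℝ) → Prop
  | 0, _, x => D x = ∅
  | k + 1, BrushPlayer.Min, x =>
      D x = ∅ ∨ ∃ v ∈ D x, ClearsWithin D h k BrushPlayer.Max (x + Pi.single v h)
  | k + 1, BrushPlayer.Max, x =>
      D x = ∅ ∨ ∀ v ∈ D x, ClearsWithin D h k BrushPlayer.Min (x + Pi.single v h)

namespace ClearsWithin

variable {g h : ℝ} {k l : ℕ} {P : BrushPlayer}

lemma of_empty (hx : D x = ∅) : ClearsWithin D h k P x := by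
  cases k with
  | zero => exact hx
  | succ k => cases P <;> exact Or.inl hx

lemma mono (hD : IsDirtyMap D) (hg : 0 ≤ g) (hgh : g ≤ h) (hkl : k ≤ l) (hxy : LoadLE D x y)
    (hx : ClearsWithin D g k P x) : ClearsWithin D h l P y := by
  induction k generalizing l P x y with
  | zero => exact of_empty (Finset.subset_empty.mp ((hD hxy).trans (Eq.subset hx)))
  | succ k ih =>
    obtain ⟨l, rfl⟩ := Nat.exists_eq_add_of_le' (k.succ_pos.trans_le hkl)
    rcases (D y).eq_empty_or_nonempty with hy | hy
    · exact of_empty hy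
    have hDx : D x ≠ ∅ := (hy.mono (hD hxy)).ne_empty
    cases P with
    | Max =>
      exact Or.inr fun v hv => ih (Nat.le_of_succ_le_succ hkl)
        (hxy.add_single hD hg hgh fun _ => rfl) (hx.resolve_left hDx v (hD hxy hv))
    | Min =>
      obtain ⟨v, -, hv⟩ := hx.resolve_left hDx
      obtain ⟨u, hu, huv⟩ := exists_mem_eq_of_mem hy v
      exact Or.inr ⟨u, hu, ih (Nat.le_of_succ_le_succ hkl) (hxy.add_single hD hg hgh huv) hv⟩

/-- Min may also pretend to play on a clean vertex `v`. -/
lemma min_of_max_add_single (hD : IsDirtyMap D) (hh : 0 ≤ h) (v : V)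
    (hx : ClearsWithin D h k .Max (x + Pi.single v h)) : ClearsWithin D h (k + 1) .Min x := by
  rcases (D x).eq_empty_or_nonempty with hx0 | hx0
  · exact of_empty hx0
  obtain ⟨u, hu, huv⟩ := exists_mem_eq_of_mem hx0 v
  exact Or.inr ⟨u, hu, hx.mono hD hh le_rfl le_rfl
    (LoadLE.add_single hD hh le_rfl (.of_le le_rfl) huv)⟩

lemma max_of_min (hD : IsDirtyMap D) (hh : 0 ≤ h) (hx : ClearsWithin D h k .Min x) :
    ClearsWithin D h (k + 1) .Max x :=
  Or.inr fun v _ => hx.mono hD hh le_rfl le_rfl (.self_add_single x v hh)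

lemma min_of_max (hD : IsDirtyMap D) (hh : 0 ≤ h) (hx : ClearsWithin D h k .Max x) :
    ClearsWithin D h (k + 1) .Min x := by
  rcases (D x).eq_empty_or_nonempty with hx0 | ⟨v, -⟩
  · exact of_empty hx0
  · exact min_of_max_add_single hD hh v (hx.mono hD hh le_rfl le_rfl (.self_add_single x v hh))

lemma exists_reply (hy : ClearsWithin D g k .Max y) {v : V} (hv : v ∈ D y) :
    v ∉ D (y + Pi.single v g) ∨
      ∃ k' u, k = k' + 2 ∧ ClearsWithin D g k' .Max (y + Pi.single v g + Pi.single u g) := by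
  by_cases hv' : v ∈ D (y + Pi.single v g)
  swap
  · exact .inl hv'
  have hne : D y ≠ ∅ := Finset.ne_empty_of_mem hv
  have hne' : D (y + Pi.single v g) ≠ ∅ := Finset.ne_empty_of_mem hv'
  match k, hy with
  | 0, hy => exact absurd hy hne
  | 1, hy => exact absurd (hy.resolve_left hne v hv) hne'
  | k' + 2, hy =>
    obtain ⟨u, -, hu⟩ := (hy.resolve_left hne v hv).resolve_left hne'
    exact .inr ⟨k', u, rfl, hu⟩

variable [Fintype V]

lemma of_add_moveLoad (hD : IsDirtyMap D) (hh : 0 ≤ h) (m : V → ℕ)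
    (hx : ClearsWithin D h k .Min (x + moveLoad h m)) :
    ClearsWithin D h (k + 2 * ∑ v, m v) .Min x := by
  induction hN : ∑ v, m v generalizing m x with
  | zero =>
    obtain rfl : m = 0 := by
      ext v
      exact Finset.sum_eq_zero_iff.mp hN v (Finset.mem_univ v)
    simpa using hx
  | succ N ih =>
    obtain ⟨v, -, hv⟩ := Finset.exists_ne_zero_of_sum_ne_zero (hN.trans_ne N.succ_ne_zero)
    have hvm : Pi.single v 1 ≤ m := fun w => by
      by_cases hwv : w = v
      · subst hwv
        simpa using Nat.one_le_iff_ne_zero.mpr hv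
      · simp [hwv]
    obtain ⟨m, rfl⟩ := exists_add_of_le hvm
    refine min_of_max_add_single hD hh v (max_of_min hD hh (ih m ?_ ?_))
    · rwa [moveLoad_add, moveLoad_single, Nat.cast_one, mul_one, ← add_assoc] at hx
    · simpa [Finset.sum_add_distrib, add_comm] using hN

/-- Min spends `j` turns on the vertex `v`, while Max makes `r w` moves on each vertex `w`. -/
lemma of_burst (hD : IsDirtyMap D) (hg : 0 ≤ g) (v : V) (j : ℕ)
    (hy : ∀ r : V → ℕ, (∀ w ∉ D y, r w = 0) → ∑ w, r w = j →
      ClearsWithin D g k .Min (y + moveLoad g (Pi.single v j + r))) :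
    ClearsWithin D g (k + 2 * j) .Min y := by
  induction j generalizing y with
  | zero => simpa using hy 0 (by simp) (by simp)
  | succ j ih =>
    refine min_of_max_add_single hD hg v (Or.inr fun m hm => ih fun r hr hrj => ?_)
    have hDy : D (y + Pi.single v g + Pi.single m g) ⊆ D y :=
      (hD.subset_add_single _ m hg).trans (hD.subset_add_single y v hg)
    have hm' : m ∈ D y := hD.subset_add_single y v hg hm
    convert hy (r + Pi.single m 1) (fun w hw => ?_) ?_ using 1
    · simp only [moveLoad_add, moveLoad_single, Pi.single_add, Nat.cast_one, mul_one]
      abel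
    · have hwm : w ≠ m := fun hwm => hw (hwm ▸ hm')
      simp [hwm, hr w fun hw' => hw (hDy hw')]
    · simp [Finset.sum_add_distrib, hrj]

/-- Max plays `j` times on the vertex `v`, or until `v` is clean, and Min replies `r w` times on
each vertex `w`. -/
lemma exists_replies (hD : IsDirtyMap D) (hg : 0 ≤ g) (hy : ClearsWithin D g k .Max y) (v : V)
    (j : ℕ) : ∃ r : V → ℕ, ∑ w, r w ≤ j ∧ ∃ k' ≤ k,
      ClearsWithin D g k' .Max (y + moveLoad g (Pi.single v j + r)) ∧
      (v ∈ D (y + moveLoad g (Pi.single v j + r)) → k' + 2 * j ≤ k) := by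
  induction j with
  | zero => exact ⟨0, by simp, k, le_rfl, by simpa using hy, by simp⟩
  | succ j ih =>
    obtain ⟨r, hrj, k', hk', hc, hv⟩ := ih
    set y' := y + moveLoad g (Pi.single v j + r) with hy'
    have hnext : y + moveLoad g (Pi.single v (j + 1) + r) = y' + Pi.single v g := by
      simp only [hy', moveLoad_add, moveLoad_single, Pi.single_add, Nat.cast_one, mul_one]
      abel
    by_cases hdirty : v ∈ D (y' + Pi.single v g)
    swap
    · refine ⟨r, hrj.trans j.le_succ, k', hk', ?_⟩
      rw [hnext]
      exact ⟨hc.mono hD hg le_rfl le_rfl (.self_add_single y' v hg), fun h => absurd h hdirty⟩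
    have hvy' : v ∈ D y' := hD.subset_add_single y' v hg hdirty
    obtain ⟨k'', u, rfl, hu⟩ := (hc.exists_reply hvy').resolve_left (not_not_intro hdirty)
    refine ⟨r + Pi.single u 1, by simpa [Finset.sum_add_distrib] using hrj, k'', by omega, ?_,
      fun _ => by have := hv hvy'; omega⟩
    rwa [← add_assoc, moveLoad_add, ← add_assoc, hnext, moveLoad_single, Nat.cast_one, mul_one]

/-- The vertex `v` pays for the replies that are missing when it becomes clean early. -/
lemma exists_replies_card_dirty (hD : IsDirtyMap D) (hg : 0 ≤ g)
    (hy : ClearsWithin D g k .Max y) {v : V} (hv : v ∈ D y) (j : ℕ) :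
    ∃ r : V → ℕ, ∑ w, r w ≤ j ∧ ∃ k',
      ClearsWithin D g k' .Max (y + moveLoad g (Pi.single v j + r)) ∧
      k' + 2 * j * (D (y + moveLoad g (Pi.single v j + r))).card + 2 * j
        ≤ k + 2 * j * (D y).card := by
  obtain ⟨r, hrj, k', hk', hc, hv'⟩ := hy.exists_replies hD hg v j
  refine ⟨r, hrj, k', hc, ?_⟩
  set y' := y + moveLoad g (Pi.single v j + r)
  have hsub : D y' ⊆ D y := hD.subset_add y fun w => mul_nonneg hg (Nat.cast_nonneg _)
  by_cases hdirty : v ∈ D y'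
  · have := Nat.mul_le_mul_left (2 * j) (Finset.card_le_card hsub)
    have := hv' hdirty
    omega
  · have hlt : (D y').card + 1 ≤ (D y).card :=
      Finset.card_lt_card ⟨hsub, fun h => hdirty (h hv)⟩
    have := Nat.mul_le_mul_left (2 * j) hlt
    rw [mul_add_one] at this
    omega

end ClearsWithin

end LoadGame

section CupGame

variable {V : Type*} {b : ℝ} {S T : Finset V} {z a : V → ℝ} {m : V}

/-- The levels `z` of the cups in `S` are kept low in the sense of the cup emptying game: every
`j` cups have average level at most `b - (1 + 1/2 + ⋯ + 1/j)`. Levels may be negative, and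
`b` allows the invariant to be shifted. -/
def CupsBalanced (b : ℝ) (S : Finset V) (z : V → ℝ) : Prop :=
  ∀ A ⊆ S, ∑ v ∈ A, z v ≤ A.card * (b - harmonic A.card)

lemma harmonic_cast_mono {j n : ℕ} (hjn : j ≤ n) : (harmonic j : ℝ) ≤ harmonic n := by
  have : harmonic j ≤ harmonic n := Finset.sum_le_sum_of_subset_of_nonneg
    (Finset.range_subset_range.mpr hjn) fun _ _ _ => by positivity
  exact_mod_cast this

lemma cupsBalanced_of_le (hz : ∀ v ∈ S, z v ≤ b - harmonic S.card) : CupsBalanced b S z :=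
  fun A hA => calc
    ∑ v ∈ A, z v ≤ A.card • (b - harmonic S.card) :=
      Finset.sum_le_card_nsmul A z _ fun v hv => hz v (hA hv)
    _ ≤ A.card * (b - harmonic A.card) := by
      rw [nsmul_eq_mul]
      have := harmonic_cast_mono (Finset.card_le_card hA)
      gcongr

namespace CupsBalanced

lemma subset (hz : CupsBalanced b S z) (hT : T ⊆ S) : CupsBalanced b T z :=
  fun A hA => hz A (hA.trans hT)

lemma le_sub_one (hz : CupsBalanced b S z) {v : V} (hv : v ∈ S) : z v ≤ b - 1 := by
  simpa [harmonic] using hz {v} (Finset.singleton_subset_iff.mpr hv)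

lemma sum_deficit_mono (hz : CupsBalanced b S z) (hT : T ⊆ S) :
    ∑ v ∈ T, (b - z v) ≤ ∑ v ∈ S, (b - z v) :=
  Finset.sum_le_sum_of_subset_of_nonneg hT fun _ hv _ => by linarith [hz.le_sub_one hv]

lemma sum_add_le (hz : CupsBalanced b S z) (ha : 0 ≤ a) (haS : ∑ v ∈ S, a v ≤ 1)
    {A : Finset V} (hA : A ⊆ S) :
    ∑ v ∈ A, (z + a) v ≤ A.card * (b - harmonic A.card) + 1 := by
  simp only [Pi.add_apply, Finset.sum_add_distrib]
  exact add_le_add (hz A hA)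
    ((Finset.sum_le_sum_of_subset_of_nonneg hA fun v _ _ => ha v).trans haS)

lemma sum_deficit_add_one_le (hz : CupsBalanced b S z) (ha : 0 ≤ a) (haS : ∑ v ∈ S, a v = 1)
    (hT : T ⊆ S) : ∑ v ∈ T, (b - (z + a) v) + 1 ≤ ∑ v ∈ S, (b - z v) := by
  have hnonneg : ∀ v ∈ S, 0 ≤ b - (z + a) v := fun v hv => by
    have hav := (Finset.single_le_sum (fun i _ => ha i) hv).trans haS.le
    have hzv := hz.le_sub_one hv
    simp only [Pi.add_apply]
    linarith
  calc ∑ v ∈ T, (b - (z + a) v) + 1 ≤ ∑ v ∈ S, (b - (z + a) v) + 1 := by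
        gcongr
        exact fun v hv _ => hnonneg v hv
    _ = ∑ v ∈ S, (b - z v) := by
        simp only [Pi.add_apply, Finset.sum_sub_distrib, Finset.sum_add_distrib, haS]
        ring

variable [DecidableEq V]

/-- Emptying the fullest cup restores the balance: on a set `A` of `j` cups avoiding `m`, the
average is at most the average on `A ∪ {m}`, where the bound for `j + 1` cups absorbs the unit
poured in. -/
lemma add_sub_single (hz : CupsBalanced b S z) (ha : 0 ≤ a) (haS : ∑ v ∈ S, a v ≤ 1)
    (hT : T ⊆ S) (hm : m ∈ T) (hmax : ∀ v ∈ T, (z + a) v ≤ (z + a) m) :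
    CupsBalanced b T (z + a - Pi.single m 1) := by
  intro A hA
  simp only [Pi.sub_apply, Finset.sum_sub_distrib, Finset.sum_pi_single']
  by_cases hmA : m ∈ A
  · rw [if_pos hmA]
    linarith [hz.sum_add_le ha haS (hA.trans hT)]
  rw [if_neg hmA, sub_zero]
  have hinsert := hz.sum_add_le ha haS (Finset.insert_subset (hT hm) (hA.trans hT))
  rw [Finset.sum_insert hmA, Finset.card_insert_of_notMem hmA, harmonic_succ] at hinsert
  have havg : ∑ v ∈ A, (z + a) v ≤ A.card * (z + a) m := by
    rw [← nsmul_eq_mul]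
    exact Finset.sum_le_card_nsmul A (z + a) _ fun v hv => hmax v (hA hv)
  push_cast at hinsert
  set j : ℝ := (A.card : ℝ)
  set H : ℝ := (harmonic A.card : ℝ)
  have hj : 0 ≤ j := Nat.cast_nonneg _
  have habsorb : (j + 1) * (b - (H + (j + 1)⁻¹)) + 1 = (j + 1) * (b - H) := by
    field_simp
    ring
  rw [habsorb] at hinsert
  have hscaled : (j + 1) * ∑ v ∈ A, (z + a) v ≤ (j + 1) * (j * (b - H)) := by
    nlinarith [mul_le_mul_of_nonneg_left hinsert hj]
  exact le_of_mul_le_mul_left hscaled (by linarith)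

/-- The second alternative occurs when no cup of `T` holds a full unit, so that nothing can be
taken out. -/
lemma exists_empty_fullest (hz : CupsBalanced b S z) (hb : 1 + harmonic S.card ≤ b) (hz0 : 0 ≤ z)
    (ha : 0 ≤ a) (haS : ∑ v ∈ S, a v = 1) (hT : T ⊆ S) (hTne : T.Nonempty) :
    ∃ m ∈ T, ∃ z' : V → ℝ, 0 ≤ z' ∧ CupsBalanced b T z' ∧
      ((z' + Pi.single m 1 = z + a ∧ ∑ v ∈ T, (b - z' v) ≤ ∑ v ∈ S, (b - z v)) ∨
        (z' = z + a ∧ ∑ v ∈ T, (b - z' v) + 1 ≤ ∑ v ∈ S, (b - z v))) := by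
  obtain ⟨m, hm, hmax⟩ := T.exists_max_image (z + a) hTne
  have hdeficit := hz.sum_deficit_add_one_le ha haS hT
  have hza : 0 ≤ z + a := add_nonneg hz0 ha
  refine ⟨m, hm, ?_⟩
  by_cases hfull : 1 ≤ (z + a) m
  · refine ⟨z + a - Pi.single m 1, sub_nonneg.mpr fun v => ?_,
      hz.add_sub_single ha haS.le hT hm hmax, .inl ⟨sub_add_cancel _ _, ?_⟩⟩
    · by_cases hvm : v = m
      · simpa [hvm] using hfull
      · simpa [hvm] using hza v
    · refine le_of_eq_of_le ?_ hdeficit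
      simp only [Pi.sub_apply, Finset.sum_sub_distrib, Finset.sum_pi_single', if_pos hm]
      ring
  · have hle : ∀ v ∈ T, (z + a) v ≤ b - harmonic T.card := fun v hv => by
      linarith [hmax v hv, not_le.mp hfull, harmonic_cast_mono (Finset.card_le_card hT)]
    exact ⟨z + a, hza, cupsBalanced_of_le hle, .inr ⟨rfl, hdeficit⟩⟩

end CupsBalanced

end CupGame

section Comparison

variable {V : Type*} {D : (V → ℝ) → Finset V} {x y z c : V → ℝ} {g h b : ℝ} {k B t L : ℕ}

lemma CupsBalanced.loadLE_of_debt (hh : 0 ≤ h) (hz : CupsBalanced 1 (D x) z)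
    (hxy : LoadLE D (y - h • z) x) : LoadLE D y x := fun v hv => by
  have hle := hxy v hv
  have hzv : z v ≤ 0 := by simpa using hz.le_sub_one hv
  simp only [Pi.sub_apply, Pi.smul_apply, smul_eq_mul] at hle
  linarith [mul_nonpos_of_nonneg_of_nonpos hh hzv]

lemma CupsBalanced.exists_eq_add_of_deficit {S : Finset V} (hz : CupsBalanced b S z)
    (hB : 2 * k * (t + ∑ v ∈ S, (b - z v)) + 2 * k ≤ (B : ℝ)) :
    ∃ B', B = B' + 2 * k ∧ 2 * k * (t + ∑ v ∈ S, (b - z v)) ≤ (B' : ℝ) := by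
  have hdeficit : 0 ≤ ∑ v ∈ S, (b - z v) := by
    simpa using hz.sum_deficit_mono (Finset.empty_subset _)
  have hkB : 2 * k ≤ B := by
    have : 0 ≤ 2 * k * (t + ∑ v ∈ S, (b - z v)) := by positivity
    exact_mod_cast (by linarith : (2 * k : ℝ) ≤ B)
  obtain ⟨B', rfl⟩ := Nat.exists_eq_add_of_le' hkB
  exact ⟨B', rfl, by push_cast at hB; linarith⟩

variable [DecidableEq V]

lemma add_moveLoad_single_add (y : V → ℝ) (g : ℝ) (hk : 0 < k) (v : V) (r : V → ℕ) :
    y + moveLoad g (Pi.single v k + r) =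
      y + Pi.single v (g * k) + (g * k) • fun w => (r w : ℝ) / k := by
  rw [moveLoad_add, moveLoad_single, moveLoad_eq_smul g hk, add_assoc]

lemma smul_single_one (h : ℝ) (m : V) : h • (Pi.single m 1 : V → ℝ) = Pi.single m h := by
  rw [← Pi.single_smul, smul_eq_mul, mul_one]

namespace ClearsWithin

/-- The level `z v` of a cup is what Min has played on `v` in the imagined short game beyond her
moves in the long one, in units of a long move. -/
lemma mul_step_of_debt [Finite V] (hD : IsDirtyMap D) (hg : 0 < g) (hk : 0 < k)
    (hy : ClearsWithin D g B .Max y) (hz : CupsBalanced 1 (D x) z)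
    (hxy : LoadLE D (y - (g * k) • z) x) (hB : B + 2 * k * (D y).card ≤ 2 * k * t) :
    ClearsWithin D (g * k) (2 * t) .Max x := by
  have := Fintype.ofFinite V
  have hgk : 0 < g * k := by positivity
  induction t generalizing B x y z with
  | zero =>
    have hcard : (D y).card = 0 := by nlinarith
    exact of_empty (Finset.subset_empty.mp
      ((hD (hz.loadLE_of_debt hgk.le hxy)).trans (Finset.card_eq_zero.mp hcard).subset))
  | succ t ih =>
    refine Or.inr fun v hv => ?_
    have hvy : v ∈ D y := hD (hz.loadLE_of_debt hgk.le hxy) hv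
    obtain ⟨r, hrk, B', hy', hB'⟩ := hy.exists_replies_card_dirty hD hg.le hvy k
    rw [add_moveLoad_single_add y g hk] at hy' hB'
    set a : V → ℝ := fun w => (r w : ℝ) / k
    have ha : 0 ≤ a := fun w => by positivity
    have haS : ∑ w ∈ D x, a w ≤ 1 := by
      rw [← Finset.sum_div, div_le_one (by positivity)]
      exact_mod_cast (Finset.sum_le_univ_sum_of_nonneg fun w => (r w).zero_le).trans hrk
    rcases (D (x + Pi.single v (g * k))).eq_empty_or_nonempty with hclean | hdirty
    · exact of_empty hclean
    obtain ⟨m, hm, hmax⟩ := Finset.exists_max_image _ (z + a) hdirty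
    have hz' := hz.add_sub_single ha haS (hD.subset_add_single x v hgk.le) hm hmax
    refine Or.inr ⟨m, hm, ih hy' (hz'.subset (hD.subset_add_single _ m hgk.le)) ?_ (by lia)⟩
    have hmoves : (0 : V → ℝ) ≤ Pi.single v (g * k) + Pi.single m (g * k) :=
      add_nonneg (Pi.single_nonneg.mpr hgk.le) (Pi.single_nonneg.mpr hgk.le)
    convert hxy.add_right hD hmoves using 1
    · rw [smul_sub, smul_add, smul_single_one]
      abel
    · rw [add_assoc]

lemma mul_step [Fintype V] (hD : IsDirtyMap D) (hg : 0 < g) (hk : 0 < k)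
    (hL : (harmonic (Fintype.card V) : ℝ) ≤ L)
    (hB : B + 1 + 2 * k * Fintype.card V ≤ 2 * k * t) (h0 : ClearsWithin D g B .Min 0) :
    ClearsWithin D (g * k) (2 * t + 1 + 2 * (Fintype.card V * L)) .Min 0 := by
  have hgk : 0 ≤ g * k := by positivity
  have hcard : ∀ S : Finset V, S.card ≤ Fintype.card V := Finset.card_le_univ
  have hmax : ClearsWithin D (g * k) (2 * t) .Max (0 + moveLoad (g * k) fun _ => L) := by
    refine mul_step_of_debt (z := fun _ => 1 - L) hD hg hk (h0.max_of_min hD hg.le)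
      (cupsBalanced_of_le fun v _ => ?_) (.of_le fun v => ?_) ?_
    · linarith [harmonic_cast_mono (hcard (D (0 + moveLoad (g * k) fun _ => L)))]
    · simp only [zero_add, Pi.sub_apply, Pi.zero_apply, Pi.smul_apply, smul_eq_mul, moveLoad]
      linarith
    · nlinarith [hcard (D 0)]
  simpa using of_add_moveLoad hD hgk (fun _ => L) (hmax.min_of_max hD hgk)

/-- One round of `of_mul_step_of_credit`: `a` is the water that Max has just poured in. When no cup
holds a full unit, Min imagines that Max plays on the fullest one and gets this move for free; the
drop of the total deficit pays for it. -/
lemma min_of_credit [Finite V] (hD : IsDirtyMap D) (hg : 0 < g) {S : Finset V} {a : V → ℝ}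
    (hxS : D x ⊆ S) (hb : 1 + harmonic S.card ≤ b) (hc : CupsBalanced b S c) (hc0 : 0 ≤ c)
    (ha : 0 ≤ a) (haS : ∑ v ∈ S, a v = 1) (hxy : LoadLE D (x + (g * k) • (c + a)) y)
    (hB : 2 * k * (t + ∑ v ∈ S, (b - c v)) ≤ (B : ℝ))
    (hnext : ∀ m ∈ D x, ∀ c' : V → ℝ, ∀ (B' : ℕ) y', 0 ≤ c' → CupsBalanced b (D x) c' →
      LoadLE D (x + Pi.single m (g * k) + (g * k) • c') y' →
      2 * k * (t + ∑ v ∈ D x, (b - c' v)) ≤ (B' : ℝ) → ClearsWithin D g B' .Min y') :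
    ClearsWithin D g B .Min y := by
  have := Fintype.ofFinite V
  have hgk : 0 ≤ g * k := by positivity
  rcases (D x).eq_empty_or_nonempty with hclean | hdirty
  · have hyx := hD (hxy.of_add_left (smul_nonneg hgk (add_nonneg hc0 ha)))
    exact of_empty (Finset.subset_empty.mp (hyx.trans hclean.subset))
  obtain ⟨m, hm, c', hc0', hc', hcase⟩ := hc.exists_empty_fullest hb hc0 ha haS hxS hdirty
  obtain ⟨hsum, hdeficit⟩ | ⟨rfl, hdeficit⟩ := hcase
  · refine hnext m hm c' B y hc0' hc' ?_ (hB.trans' (by gcongr))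
    rwa [← hsum, smul_add, smul_single_one, add_comm (_ • c'), ← add_assoc] at hxy
  · have hpaid : 2 * k * (t + ∑ v ∈ D x, (b - (c + a) v)) + 2 * k ≤ (B : ℝ) := by
      refine hB.trans' ?_
      nlinarith [mul_le_mul_of_nonneg_left hdeficit (by positivity : 0 ≤ 2 * (k : ℝ))]
    obtain ⟨B', rfl, hB'⟩ := hc'.exists_eq_add_of_deficit hpaid
    have hfree : ClearsWithin D g B' .Min (y + moveLoad g (Pi.single m k)) := by
      refine hnext m hm (c + a) B' _ hc0' hc' ?_ hB'
      rw [moveLoad_single, add_right_comm]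
      exact hxy.add_right hD (Pi.single_nonneg.mpr hgk)
    simpa using of_add_moveLoad hD hg.le (Pi.single m k) hfree

/-- The level `c v` of a cup is what Max has played on `v` in the short game beyond his moves in
the imagined long one, in units of a long move. -/
lemma of_mul_step_of_credit [Finite V] (hD : IsDirtyMap D) (hg : 0 < g) (hk : 0 < k)
    (hx : ClearsWithin D (g * k) (2 * t) .Min x) (hb : 1 + harmonic (D x).card ≤ b)
    (hc : CupsBalanced b (D x) c) (hc0 : 0 ≤ c) (hxy : LoadLE D (x + (g * k) • c) y)
    (hB : 2 * k * (t + ∑ v ∈ D x, (b - c v)) ≤ (B : ℝ)) :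
    ClearsWithin D g B .Min y := by
  have := Fintype.ofFinite V
  have hgk : 0 ≤ g * k := by positivity
  induction t generalizing B x y c with
  | zero =>
    exact of_empty (Finset.subset_empty.mp
      ((hD (hxy.of_add_left (smul_nonneg hgk hc0))).trans (Eq.subset hx)))
  | succ t ih =>
    have hyx : D y ⊆ D x := hD (hxy.of_add_left (smul_nonneg hgk hc0))
    rcases (D x).eq_empty_or_nonempty with hclean | hdirty
    · exact of_empty (Finset.subset_empty.mp (hyx.trans hclean.subset))
    obtain ⟨v, -, hv⟩ := hx.resolve_left hdirty.ne_empty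
    obtain ⟨B, rfl, hB'⟩ := hc.exists_eq_add_of_deficit (k := k) (t := t)
      (hB.trans' (by push_cast; linarith))
    refine of_burst hD hg.le v k fun r hr hrk => ?_
    have haS : ∑ w ∈ D x, (r w : ℝ) / k = 1 := by
      rw [← Finset.sum_div, div_eq_one_iff_eq (by positivity), ← hrk, Nat.cast_sum]
      refine Finset.sum_subset (Finset.subset_univ _) fun w _ hw => ?_
      exact_mod_cast hr w fun hwy => hw (hyx hwy)
    have hpour : (0 : V → ℝ) ≤ moveLoad g (Pi.single v k + r) :=
      fun w => mul_nonneg hg.le (Nat.cast_nonneg _)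
    refine min_of_credit hD hg (hD.subset_add_single x v hgk) hb hc hc0
      (fun w => by positivity) haS ?_ hB'
      fun m hm c' _ y' hc0' hc' hxy' hcredit => ?_
    · convert hxy.add_right hD hpour using 1
      rw [moveLoad_add, moveLoad_single, moveLoad_eq_smul g hk, smul_add]
      abel
    · have hxm := hD.subset_add_single (x + Pi.single v (g * k)) m hgk
      have hxv := hD.subset_add_single x v hgk
      have hx' := (hv.resolve_left (Finset.ne_empty_of_mem hm)) m hm
      refine ih hx' ?_ (hc'.subset hxm) hc0' hxy' (hcredit.trans' ?_)
      · linarith [harmonic_cast_mono (Finset.card_le_card (hxm.trans hxv))]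
      · have := hc'.sum_deficit_mono hxm
        gcongr

lemma of_mul_step [Fintype V] (hD : IsDirtyMap D) (hg : 0 < g) (hk : 0 < k)
    (hL : (harmonic (Fintype.card V) : ℝ) ≤ L) (h0 : ClearsWithin D (g * k) t .Min 0) :
    ClearsWithin D g (k * (t + 1) + 2 * k * (Fintype.card V * (L + 1))) .Min 0 := by
  have hgk : 0 ≤ g * k := by positivity
  have hharm : (harmonic (D 0).card : ℝ) ≤ L :=
    (harmonic_cast_mono (Finset.card_le_univ _)).trans hL
  refine of_mul_step_of_credit (t := (t + 1) / 2) (b := 1 + L) (c := 0) hD hg hk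
    (h0.mono hD hgk le_rfl (by lia) (.of_le le_rfl)) (by gcongr)
    (cupsBalanced_of_le fun v _ => ?_) le_rfl (.of_le (by simp)) ?_
  · simp only [Pi.zero_apply]
    linarith
  · have hhalf : 2 * (((t + 1) / 2 : ℕ) : ℝ) ≤ t + 1 := by exact_mod_cast Nat.mul_div_le (t + 1) 2
    have hcard : ((D 0).card : ℝ) ≤ Fintype.card V := by
      exact_mod_cast Finset.card_le_univ (D 0)
    simp only [Pi.zero_apply, sub_zero, Finset.sum_const, nsmul_eq_mul]
    push_cast
    have hn : ((D 0).card : ℝ) * (1 + L) ≤ Fintype.card V * (L + 1) := by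
      rw [add_comm (L : ℝ)]
      gcongr
    calc 2 * (k : ℝ) * (((t + 1) / 2 : ℕ) + (D 0).card * (1 + L))
        = k * (2 * ((t + 1) / 2 : ℕ)) + 2 * k * ((D 0).card * (1 + L)) := by ring
      _ ≤ k * (t + 1) + 2 * k * (Fintype.card V * (L + 1)) := by gcongr

end ClearsWithin

end Comparison

section GraphGame

variable {V : Type*} {G : SimpleGraph V} {S T : Finset V} {u v : V}

open Classical in
/-- The number of neighbours of `v` in `S`. -/
noncomputable def nbrsIn (G : SimpleGraph V) (S : Finset V) (v : V) : ℕ :=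
  (S.filter fun u => G.Adj v u).card

lemma nbrsIn_mono (h : S ⊆ T) (v : V) : nbrsIn G S v ≤ nbrsIn G T v := by
  classical
  exact Finset.card_le_card (Finset.filter_subset_filter _ h)

lemma nbrsIn_erase_add_one [DecidableEq V] (hv : v ∈ S) (huv : G.Adj u v) :
    nbrsIn G (S.erase v) u + 1 = nbrsIn G S u := by
  classical
  rw [nbrsIn, Finset.filter_erase]
  exact Finset.card_erase_add_one (Finset.mem_filter.mpr ⟨hv, huv⟩)

lemma nbrsIn_erase_of_not_adj [DecidableEq V] (huv : ¬G.Adj u v) :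
    nbrsIn G (S.erase v) u = nbrsIn G S u := by
  classical
  rw [nbrsIn, Finset.filter_erase,
    Finset.erase_eq_of_notMem fun h => huv (Finset.mem_filter.mp h).2, nbrsIn]

variable [Fintype V] {x : V → ℝ} {p : ℝ} {s : BrushState V}

/-- No vertex of `S` can fire when `S` is the set of dirty vertices and `x v` is the number of
brushes placed on `v`, in units of `p`: besides these, `v` holds one unit for each of its clean
neighbours. -/
def IsStuck (G : SimpleGraph V) (x : V → ℝ) (S : Finset V) : Prop :=
  ∀ v ∈ S, x v + nbrsIn G Finset.univ v < 2 * nbrsIn G S v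

open Classical in
/-- The largest stuck set: the vertices that remain dirty when `x v` brushes, in units of `p`,
have been placed on each `v` and no vertex can fire. -/
noncomputable def dirtySet (G : SimpleGraph V) (x : V → ℝ) : Finset V :=
  Finset.univ.filter fun v => ∃ S, IsStuck G x S ∧ v ∈ S

lemma IsStuck.subset_dirtySet (hS : IsStuck G x S) : S ⊆ dirtySet G x := by
  classical
  intro v hv
  simpa [dirtySet] using ⟨S, hS, hv⟩

variable (G x) in
lemma isStuck_dirtySet : IsStuck G x (dirtySet G x) := by
  classical
  intro v hv
  obtain ⟨S, hS, hvS⟩ := (Finset.mem_filter.mp hv).2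
  have hmono : (nbrsIn G S v : ℝ) ≤ nbrsIn G (dirtySet G x) v := by
    exact_mod_cast nbrsIn_mono hS.subset_dirtySet v
  linarith [hS v hvS]

variable (G) in
lemma isDirtyMap_dirtySet : IsDirtyMap (dirtySet G) := fun _ y hxy =>
  IsStuck.subset_dirtySet fun v hv =>
    (add_le_add_left (hxy v hv) _).trans_lt (isStuck_dirtySet G y v hv)

variable (G) in
lemma dirtySet_zero_eq_empty [Subsingleton V] : dirtySet G 0 = ∅ := by
  classical
  refine Finset.eq_empty_of_forall_notMem fun v hv => ?_
  have hisolated : nbrsIn G (dirtySet G 0) v = 0 :=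
    Finset.card_eq_zero.mpr (Finset.filter_eq_empty_iff.mpr fun u _ hu =>
      hu.ne (Subsingleton.elim v u))
  have hstuck := isStuck_dirtySet G 0 v hv
  rw [hisolated, Pi.zero_apply, zero_add, Nat.cast_zero, mul_zero] at hstuck
  exact absurd hstuck (Nat.cast_nonneg _).not_gt

/-- The position `s` arises by firing some vertices after `p * x v` brushes have been placed on
each vertex `v`. -/
def Represents (G : SimpleGraph V) (p : ℝ) (x : V → ℝ) (s : BrushState V) : Prop :=
  dirtySet G x ⊆ s.dirty ∧ ∀ u ∈ s.dirty,
    s.brushes u = p * (x u + nbrsIn G Finset.univ u - nbrsIn G s.dirty u)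

namespace Represents

lemma notMem_dirtySet_of_ready (hp : 0 < p) (hs : Represents G p x s) (hv : s.Ready p G v) :
    v ∉ dirtySet G x := fun hvD => by
  have hbrushes : (nbrsIn G s.dirty v : ℝ) ≤ x v + nbrsIn G Finset.univ v - nbrsIn G s.dirty v :=
    le_of_mul_le_mul_left (hv.2.trans_eq (hs.2 v hv.1)) hp
  have hmono : (nbrsIn G (dirtySet G x) v : ℝ) ≤ nbrsIn G s.dirty v := by
    exact_mod_cast nbrsIn_mono hs.1 v
  linarith [isStuck_dirtySet G x v hvD]

lemma fire (hp : 0 < p) (hs : Represents G p x s) (hv : s.Ready p G v) :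
    Represents G p x (s.fire p G v) := by
  classical
  refine ⟨fun u hu => Finset.mem_erase.mpr ⟨?_, hs.1 hu⟩, fun u hu => ?_⟩
  · rintro rfl
    exact hs.notMem_dirtySet_of_ready hp hv hu
  obtain ⟨huv, hus⟩ := Finset.mem_erase.mp hu
  have hdirty : (s.fire p G v).dirty = s.dirty.erase v := rfl
  rw [hdirty]
  by_cases hadj : G.Adj v u
  · have hbrushes : (s.fire p G v).brushes u = s.brushes u + p := by
      simp [BrushState.fire, BrushState.dirtyNbrs, huv, hus, hadj]
    rw [hbrushes, hs.2 u hus, ← nbrsIn_erase_add_one hv.1 hadj.symm]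
    push_cast
    ring
  · have hbrushes : (s.fire p G v).brushes u = s.brushes u := by
      simp [BrushState.fire, BrushState.dirtyNbrs, huv, hadj]
    rw [hbrushes, hs.2 u hus, nbrsIn_erase_of_not_adj fun h => hadj h.symm]

lemma stabilize (hp : 0 < p) (hs : Represents G p x s) :
    Represents G p x (s.stabilize p G) ∧ (s.stabilize p G).dirty = dirtySet G x := by
  induction s using BrushState.stabilize.induct p G with
  | case1 s h ih =>
    rw [BrushState.stabilize, dif_pos h]
    exact ih (hs.fire hp h.choose_spec)
  | case2 s h =>
    rw [BrushState.stabilize, dif_neg h]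
    refine ⟨hs, subset_antisymm (IsStuck.subset_dirtySet fun v hv => ?_) hs.1⟩
    have hnotReady : s.brushes v < p * nbrsIn G s.dirty v :=
      not_le.mp fun hle => h ⟨v, hv, hle⟩
    rw [hs.2 v hv] at hnotReady
    linarith [lt_of_mul_lt_mul_left hnotReady hp.le]

lemma place [DecidableEq V] (hp : 0 < p) (hs : Represents G p x s) (v : V) :
    Represents G p (x + Pi.single v p⁻¹) (s.place v) := by
  have hsub := (isDirtyMap_dirtySet G).subset_add_single x v (inv_nonneg.mpr hp.le)
  refine ⟨hsub.trans hs.1, fun u hu => ?_⟩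
  have hdirty : (s.place v).dirty = s.dirty := rfl
  rw [hdirty] at hu ⊢
  by_cases huv : u = v
  · subst huv
    simp only [BrushState.place, Function.update_self, hs.2 u hu, Pi.add_apply, Pi.single_eq_same]
    field_simp
    ring
  · simp [BrushState.place, huv, hs.2 u hu]

end Represents

lemma endsWithin_iff_clearsWithin [DecidableEq V] (hp : 0 < p) {k : ℕ} {P : BrushPlayer}
    (hs : Represents G p x s) (hd : s.dirty = dirtySet G x) :
    EndsWithin p G k P s ↔ ClearsWithin (dirtySet G) p⁻¹ k P x := by
  induction k generalizing P x s with
  | zero => simp only [EndsWithin, ClearsWithin, hd]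
  | succ k ih =>
    have hplay : ∀ Q v, EndsWithin p G k Q (s.play p G v) ↔
        ClearsWithin (dirtySet G) p⁻¹ k Q (x + Pi.single v p⁻¹) := fun Q v =>
      have hnext := (hs.place hp v).stabilize hp
      ih hnext.1 hnext.2
    cases P <;> simp only [EndsWithin, ClearsWithin, hd, hplay]

lemma endsWithin_start_iff [DecidableEq V] (hp : 0 < p) {k : ℕ} :
    EndsWithin p G k .Min (BrushState.start p G) ↔
      ClearsWithin (dirtySet G) p⁻¹ k .Min 0 := by
  have hinit : Represents G p 0 (⟨Finset.univ, fun _ => 0⟩ : BrushState V) :=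
    ⟨Finset.subset_univ _, fun u _ => by simp⟩
  have hstart := hinit.stabilize hp
  exact endsWithin_iff_clearsWithin hp hstart.1 hstart.2

lemma fracGameBrushNumber_le [DecidableEq V] (hp : 0 < p) {k : ℕ}
    (h : ClearsWithin (dirtySet G) p⁻¹ k .Min 0) : fracGameBrushNumber p G ≤ k :=
  Nat.sInf_le ((endsWithin_start_iff hp).mpr h)

variable (G)

lemma clearsWithin_fracGameBrushNumber [DecidableEq V] (hp : 0 < p) :
    ClearsWithin (dirtySet G) p⁻¹ (fracGameBrushNumber p G) .Min 0 :=
  (endsWithin_start_iff hp).mp (endsWithin_fracGameBrushNumber hp.le G)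

lemma fracGameBrushNumber_eq_zero [Subsingleton V] (hp : 0 < p) : fracGameBrushNumber p G = 0 := by
  classical
  exact Nat.le_zero.mp (fracGameBrushNumber_le hp (.of_empty (dirtySet_zero_eq_empty G)))

lemma monotoneOn_fracGameBrushNumber :
    MonotoneOn (fun p => fracGameBrushNumber p G) (Set.Ioi 0) := by
  classical
  intro p hp q hq hpq
  exact fracGameBrushNumber_le hp <| (clearsWithin_fracGameBrushNumber G hq).mono
    (isDirtyMap_dirtySet G) (inv_nonneg.mpr (le_of_lt hq)) (inv_anti₀ hp hpq) le_rfl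
    (.of_le le_rfl)

lemma abs_mul_fracGameBrushNumber_sub_le (hp : 0 < p) {k L : ℕ} (hk : 0 < k)
    (hL : (harmonic (Fintype.card V) : ℝ) ≤ L) :
    |k * (fracGameBrushNumber p G : ℝ) - fracGameBrushNumber (k * p) G| ≤
      k * (2 * (Fintype.card V * (L + 1)) + 3) := by
  classical
  have hkp : 0 < k * p := by positivity
  have hg : 0 < (k * p)⁻¹ := inv_pos.mpr hkp
  have hgk : p⁻¹ = (k * p)⁻¹ * k := by field_simp
  have hD := isDirtyMap_dirtySet G
  have hshort := clearsWithin_fracGameBrushNumber G hkp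
  have hlong := clearsWithin_fracGameBrushNumber G hp
  set n := Fintype.card V
  set B := fracGameBrushNumber (k * p) G
  have hupper : fracGameBrushNumber p G ≤ 2 * (B / (2 * k) + 1 + n) + 1 + 2 * (n * L) := by
    refine fracGameBrushNumber_le hp (hgk ▸ hshort.mul_step hD hg hk hL ?_)
    have := Nat.lt_mul_div_succ B (by positivity : 0 < 2 * k)
    rw [mul_add]
    gcongr
    exact this
  have hlower : B ≤ k * (fracGameBrushNumber p G + 1) + 2 * k * (n * (L + 1)) :=
    fracGameBrushNumber_le hkp (.of_mul_step hD hg hk hL (hgk ▸ hlong))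
  have hdiv : 2 * k * (B / (2 * k)) ≤ B := Nat.mul_div_le B (2 * k)
  have hupper' : k * fracGameBrushNumber p G ≤ B + k * (2 * (n * (L + 1)) + 3) := by
    nlinarith [Nat.mul_le_mul_left k hupper]
  rw [abs_le]
  constructor
  · have : (B : ℝ) ≤ k * (fracGameBrushNumber p G + 1) + 2 * k * (n * (L + 1)) := by
      exact_mod_cast hlower
    linarith
  · have : (k : ℝ) * fracGameBrushNumber p G ≤ B + k * (2 * (n * (L + 1)) + 3) := by
      exact_mod_cast hupper'
    linarith

end GraphGame

section ApproximateHomogeneity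

variable {F : ℝ → ℝ} {K : ℝ}

lemma abs_sub_mul_le_of_one_le (hF : MonotoneOn F (Set.Ioi 0))
    (hK : ∀ k : ℕ, 0 < k → |k * F 1 - F k| ≤ k * K) {x : ℝ} (hx : 1 ≤ x) :
    |F x - x * F 1| ≤ x * K + (|F 1| + K) := by
  set a := ⌊x⌋₊
  have hx0 : 0 < x := one_pos.trans_le hx
  have ha : 0 < a := Nat.floor_pos.mpr hx
  have ha' : (0 : ℝ) < a := by exact_mod_cast ha
  have hax : (a : ℝ) ≤ x := Nat.floor_le hx0.le
  have hxa : x < a + 1 := Nat.lt_floor_add_one x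
  have hK0 : 0 ≤ K := by simpa using (abs_nonneg _).trans (hK 1 one_pos)
  have hlow : F a ≤ F x := hF ha' hx0 hax
  have hup : F x ≤ F (a + 1 : ℕ) :=
    hF hx0 (Set.mem_Ioi.mpr (by positivity)) (by exact_mod_cast hxa.le)
  have hFa := (abs_le.mp (hK a ha)).2
  have hFa' := (abs_le.mp (hK (a + 1) a.succ_pos)).1
  push_cast at hFa' hup
  have hneg := neg_abs_le (F 1)
  have hpos := le_abs_self (F 1)
  rw [abs_le]
  constructor <;> nlinarith

/-- Multiplying by a large integer `N` makes the rounding error in `F (N * p) ≈ N * p * F 1`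
negligible against `N`. -/
lemma abs_sub_mul_le_of_monotoneOn (hF : MonotoneOn F (Set.Ioi 0))
    (hK : ∀ p > 0, ∀ k : ℕ, 0 < k → |k * F p - F (k * p)| ≤ k * K) {p : ℝ} (hp : 0 < p) :
    |F p - p * F 1| ≤ (1 + p) * K := by
  by_contra! hlt
  set d := |F p - p * F 1| - (1 + p) * K with hd
  have hd0 : 0 < d := sub_pos.mpr hlt
  obtain ⟨N, hN⟩ := exists_nat_gt (max p⁻¹ ((|F 1| + K) / d))
  obtain ⟨hNp, hNd⟩ := max_lt_iff.mp hN
  have hN0 : (0 : ℝ) < N := (inv_pos.mpr hp).trans hNp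
  have hmul := hK p hp N (by exact_mod_cast hN0)
  have hround : |F (N * p) - N * p * F 1| ≤ N * p * K + (|F 1| + K) :=
    abs_sub_mul_le_of_one_le hF (by simpa using hK 1 one_pos)
      ((inv_lt_iff_one_lt_mul₀ hp).mp hNp).le
  have hsum : N * |F p - p * F 1| ≤ N * K + (N * p * K + (|F 1| + K)) :=
    calc N * |F p - p * F 1| = |(N * F p - F (N * p)) + (F (N * p) - N * p * F 1)| := by
          rw [← abs_of_pos hN0, ← abs_mul, abs_of_pos hN0]
          ring_nf
      _ ≤ _ := (abs_add_le _ _).trans (add_le_add hmul hround)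
  have hNd' : |F 1| + K < N * d := (div_lt_iff₀ hd0).mp hNd
  rw [hd] at hNd'
  linarith

end ApproximateHomogeneity

theorem mainTheorem3_general {V : Type*} [Fintype V] (G : SimpleGraph V) {p : ℝ} (hp : 0 < p) :
    |(fracGameBrushNumber p G : ℝ) - p * gameBrushNumber G| ≤
      16 * (1 + p) * ((Fintype.card V : ℝ) * Real.log (Fintype.card V : ℝ)) := by
  rcases le_or_gt (Fintype.card V) 1 with hn | hn
  · have := Fintype.card_le_one_iff_subsingleton.mp hn
    rw [gameBrushNumber, fracGameBrushNumber_eq_zero G hp, fracGameBrushNumber_eq_zero G one_pos,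
      Nat.cast_zero, mul_zero, sub_zero, abs_zero]
    exact mul_nonneg (by positivity) (mul_nonneg (Nat.cast_nonneg _) (Real.log_natCast_nonneg _))
  have hharmonic := (harmonic_le_one_add_log (Fintype.card V)).trans (Nat.le_ceil _)
  have hn2 : (2 : ℝ) ≤ Fintype.card V := by exact_mod_cast hn
  set n : ℝ := (Fintype.card V : ℝ)
  set L := ⌈1 + Real.log n⌉₊
  have hlog : 0.69 ≤ Real.log n := by
    linarith [Real.log_two_gt_d9, Real.log_le_log two_pos hn2]
  have hL : (L : ℝ) < 2 + Real.log n := by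
    linarith [Nat.ceil_lt_add_one (by linarith : 0 ≤ 1 + Real.log n)]
  have hmono : MonotoneOn (fun q => (fracGameBrushNumber q G : ℝ)) (Set.Ioi 0) :=
    Nat.mono_cast.comp_monotoneOn (monotoneOn_fracGameBrushNumber G)
  calc _ ≤ (1 + p) * (2 * (n * (L + 1)) + 3) :=
        abs_sub_mul_le_of_monotoneOn hmono
          (fun _ hq _ hk => abs_mul_fracGameBrushNumber_sub_le G hq hk hharmonic) hp
    _ ≤ (1 + p) * (16 * (n * Real.log n)) := by
        gcongr
        nlinarith
    _ = 16 * (1 + p) * (n * Real.log n) := by ring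

theorem mainTheorem3 :
    ∃ (C : ℝ) (ε : ℕ → ℝ), Filter.Tendsto ε Filter.atTop (nhds 0) ∧
      ∀ (V : Type*) [Fintype V] (G : SimpleGraph V) (p : ℝ), 0 < p → p ≤ 1 →
        ∃ δ e : ℝ, |δ| ≤ ε (Fintype.card V) ∧
          |e| ≤ C * ((Fintype.card V : ℝ) * Real.log (Fintype.card V : ℝ)) ∧
          (fracGameBrushNumber p G : ℝ) = (1 + δ) * (p * (gameBrushNumber G : ℝ)) + e := by
  refine ⟨32, fun _ => 0, tendsto_const_nhds, fun V _ G p hp hp1 =>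
    ⟨0, _, by simp, (mainTheorem3_general G hp).trans ?_, by ring⟩⟩
  gcongr
  linarith
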